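/- \textbf{Setting.} Let $\mathsf X\subseteq\mathbb R^D$ be measurable, $\lambda$ the Lebesgue measure on $\mathsf X$, and let $\mathsf X_1,\dots,\mathsf X_d$ be a partition of $\mathsf X$ into measurable strata. Let $\pi$ be a probability density on $\mathsf X$ with respect to $\lambda$. Let $\Theta$ be the set of $\theta\in(\mathbb R_+^*)^d$ with $\sum_{i=1}^d\theta(i)=1$. For $\theta\in\Theta$ put $$\theta_\star(i)=\int_{\mathsf X_i}\pi\,d\lambda,\qquad \pi_\theta(x)=\Big(\sum_{j=1}^d\frac{\theta_\star(j)}{\theta(j)}\Big)^{-1}\sum_{i=1}^d\frac{\pi(x)}{\theta(i)}\mathbf 1_{\mathsf X_i}(x).$$ Let $(P_\theta)_{\theta\in\Theta}$ be Markov transition kernels on $\mathsf X$, and let $\gamma>0$, $X_0\in\mathsf X$ and $\tilde\theta_0\in(\mathbb R_+^*)^d$ be deterministic. The SHUS (Self-Healing Umbrella Sampling) algorithm builds random sequences $(X_n)_{n\ge0}$, $(\tilde\theta_n)_{n\ge 0}$ as follows: for $n\ge0$, $\theta_n=\tilde\theta_n/\sum_{j=1}^d\tilde\theta_n(j)$;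 the conditional law of $X_{n+1}$ given $\sigma(X_0,\dots,X_n)$ is $P_{\theta_n}(X_n,\cdot)$; and $\tilde\theta_{n+1}(i)=\tilde\theta_n(i)+\gamma\,\theta_n(i)\mathbf 1_{\mathsf X_i}(X_{n+1})$ for all $i$. Its stepsizes are $\gamma_{n+1}=\gamma/\sum_{j=1}^d\tilde\theta_n(j)$ for $n\in\mathbb N=\{0,1,2,\dots\}$. \textbf{Proposition.} (1) With probability one, the sequence $(\gamma_n)_{n\ge1}$ is (strictly) decreasing and $$\forall n\in\mathbb N,\qquad \frac{\gamma_1}{1+n\gamma_1}\le\gamma_{n+1}\le\frac{\gamma_1}{\sqrt{1+2n\gamma_1\min_{1\le i\le d}\theta_0(i)}}.$$ (2) Assume moreover that (A1) $0<\inf_{\mathsf X}\pi\le\sup_{\mathsf X}\pi<\infty$ and $\min_{1\le i\le d}\lambda(\mathsf X_i)>0$; (A2) there is a symmetric measurable function $q:\mathsf X^2\to\mathbb R$ with $\inf_{\mathsf X^2}q>0$ and $\int_{\mathsf X}q(x,y)\,d\lambda(y)=1$ for all $x\in\mathsf X$ such that, for every $\theta\in\Theta$, $P_\theta$ is the Metropolis--Hastings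 kernel with proposal kernel $q(x,y)\,d\lambda(y)$ and target density $\pi_\theta$. Then there is a random variable $C$ such that $$\mathbb P\Big(C>0\ \text{ and }\ \sup_{n\in\mathbb N}n^{\frac{1+C}{2}}\gamma_{n+1}<\infty\Big)=1.$$ -/

import Mathlib

open MeasureTheory ProbabilityTheory
open scoped ENNReal

noncomputable section

namespace SHUS

/-- Vectors of positive (not necessarily normalized) weights of the `d` strata. -/
def PosWeight (d : ℕ) : Type := {w : Fin d → ℝ // ∀ i, 0 < w i}

/-- The set `Θ` of positive probability vectors on the `d` strata. -/
def Theta (d : ℕ) : Type := {θ : Fin d → ℝ // (∀ i, 0 < θ i) ∧ ∑ i, θ i = 1}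

theorem PosWeight.sum_pos {d : ℕ} [NeZero d] (w : PosWeight d) : 0 < ∑ j, w.1 j :=
  Finset.sum_pos (fun i _ => w.2 i) Finset.univ_nonempty

/-- The normalized weights `θ(i) = w(i) / ∑ j, w(j)`. -/
def normalize {d : ℕ} [NeZero d] (w : PosWeight d) : Theta d :=
  ⟨fun i => w.1 i / ∑ j, w.1 j,
    fun i => div_pos (w.2 i) w.sum_pos,
    by rw [← Finset.sum_div]; exact div_self w.sum_pos.ne'⟩

section Algorithm

variable {𝕏 : Type*} {d : ℕ} [NeZero d]

/-- One update of the weights when the new sample is `x`: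
`w(i) + γ θ(i) 1_{𝕏_i}(x)`, where `θ` is the normalization of `w`. -/
def update (A : Fin d → Set 𝕏) (γ : ℝ) (hγ : 0 < γ) (w : PosWeight d) (x : 𝕏) : PosWeight d :=
  ⟨fun i => w.1 i + γ * (normalize w).1 i * (A i).indicator 1 x,
    fun i => add_pos_of_pos_of_nonneg (w.2 i)
      (mul_nonneg (mul_nonneg hγ.le ((normalize w).2.1 i).le)
        (Set.indicator_nonneg (fun _ _ => zero_le_one) x))⟩

/-- The unnormalized weights at time `n` along the trajectory `x`, started at `w₀` at time `0`. -/
def weight (A : Fin d → Set 𝕏) (γ : ℝ) (hγ : 0 < γ) (w₀ : PosWeight d) (x : ℕ → 𝕏) :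
    ℕ → PosWeight d
  | 0 => w₀
  | n + 1 => update A γ hγ (weight A γ hγ w₀ x n) (x (n + 1))

/-- The normalized weights `θ_n ∈ Θ` along the trajectory `x`. -/
def theta (A : Fin d → Set 𝕏) (γ : ℝ) (hγ : 0 < γ) (w₀ : PosWeight d) (x : ℕ → 𝕏) (n : ℕ) :
    Theta d :=
  normalize (weight A γ hγ w₀ x n)

/-- The stepsize `γ_n = γ / ∑ j, w_{n-1}(j)`, for `n ≥ 1`. -/
def stepsize (A : Fin d → Set 𝕏) (γ : ℝ) (hγ : 0 < γ) (w₀ : PosWeight d) (x : ℕ → 𝕏) (n : ℕ) :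
    ℝ :=
  γ / ∑ j, (weight A γ hγ w₀ x (n - 1)).1 j

variable [MeasurableSpace 𝕏]

/-- `A 0, …, A (d - 1)` is a measurable partition of the state space into strata. -/
structure IsStrata (A : Fin d → Set 𝕏) : Prop where
  measurableSet : ∀ i, MeasurableSet (A i)
  disjoint : Pairwise fun i j => Disjoint (A i) (A j)
  iUnion_eq : ⋃ i, A i = Set.univ

/-- The sigma-algebra generated by `X 0, …, X n`. -/
abbrev past {Ω : Type*} (X : ℕ → Ω → 𝕏) (n : ℕ) : MeasurableSpace Ω :=
  ⨆ k ≤ n, MeasurableSpace.comap (X k) inferInstance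

/-- `X` is the sequence of samples of the SHUS algorithm with strata `A`, kernels `P θ`,
parameter `γ`, started at the deterministic point `x₀` with the deterministic weights `w₀`:
given the past up to time `n`, `X (n + 1)` is drawn from `P θ_n (X n, ·)`. -/
structure IsSHUS (A : Fin d → Set 𝕏) (P : Theta d → Kernel 𝕏 𝕏) (γ : ℝ) (hγ : 0 < γ)
    (x₀ : 𝕏) (w₀ : PosWeight d) {Ω : Type*} [MeasurableSpace Ω] (μ : Measure Ω)
    (X : ℕ → Ω → 𝕏) : Prop where
  measurable : ∀ n, Measurable (X n)
  initial : ∀ ω, X 0 ω = x₀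
  transition : ∀ n, ∀ B : Set 𝕏, MeasurableSet B →
    μ[(X (n + 1) ⁻¹' B).indicator (fun _ => (1 : ℝ)) | past X n] =ᵐ[μ]
      fun ω => (P (theta A γ hγ w₀ (fun k => X k ω) n) (X n ω)).real B

end Algorithm

section Target

variable {𝕏 : Type*} [MeasurableSpace 𝕏] {d : ℕ}

/-- `p` is a probability density with respect to `ν`. -/
structure IsProbDensity (ν : Measure 𝕏) (p : 𝕏 → ℝ) : Prop where
  measurable : Measurable p
  nonneg : ∀ x, 0 ≤ p x
  lintegral_eq_one : ∫⁻ x, ENNReal.ofReal (p x) ∂ν = 1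

/-- The weights `θ⋆(i)` of the strata under the target density `p`. -/
def thetaStar (ν : Measure 𝕏) (A : Fin d → Set 𝕏) (p : 𝕏 → ℝ) (i : Fin d) : ℝ :=
  ∫ x in A i, p x ∂ν

/-- The biased density
`(∑ j, θ⋆(j) / θ(j))⁻¹ * ∑ i, p(x) / θ(i) * 1_{𝕏_i}(x)`. -/
def biased (ν : Measure 𝕏) (A : Fin d → Set 𝕏) (p : 𝕏 → ℝ) (θ : Theta d) (x : 𝕏) : ℝ :=
  (∑ j, thetaStar ν A p j / θ.1 j)⁻¹ * ∑ i, p x / θ.1 i * (A i).indicator 1 x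

open Classical in
/-- The Metropolis-Hastings acceptance probability of the move from `x` to `y`, for the target
density `p` and the proposal density `q`. -/
def acceptance (q : 𝕏 → 𝕏 → ℝ) (p : 𝕏 → ℝ) (x y : 𝕏) : ℝ :=
  if p x * q x y = 0 then 1 else min 1 (p y * q y x / (p x * q x y))

/-- The Metropolis-Hastings transition probability from `x`: a move to `y` proposed with density
`q x y` with respect to `ν` is accepted with probability `acceptance q p x y`; otherwise the
chain stays at `x`. -/
def metropolisHastings (ν : Measure 𝕏) (q : 𝕏 → 𝕏 → ℝ) (p : 𝕏 → ℝ) (x : 𝕏) : Measure 𝕏 :=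
  ν.withDensity (fun y => ENNReal.ofReal (q x y * acceptance q p x y)) +
    (∫⁻ y, ENNReal.ofReal (q x y * (1 - acceptance q p x y)) ∂ν) • Measure.dirac x

/-- The assumption on the target: the density is bounded and bounded away from `0`, and every
stratum has positive measure. -/
structure TargetAssumption (ν : Measure 𝕏) (A : Fin d → Set 𝕏) (p : 𝕏 → ℝ) : Prop where
  lower : ∃ m, 0 < m ∧ ∀ x, m ≤ p x
  upper : ∃ M, ∀ x, p x ≤ M
  strata_pos : ∀ i, 0 < ν (A i)

/-- The assumption on the kernels: there is a symmetric proposal density `q` with respect to `ν`,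
not depending on `θ` and bounded away from `0`, such that each `P θ` is the Metropolis-Hastings
kernel with proposal density `q` and target density `biased ν A p θ`. -/
def KernelAssumption (ν : Measure 𝕏) (A : Fin d → Set 𝕏) (p : 𝕏 → ℝ)
    (P : Theta d → Kernel 𝕏 𝕏) : Prop :=
  ∃ q : 𝕏 → 𝕏 → ℝ, Measurable (Function.uncurry q) ∧
    (∀ x, IsProbDensity ν (q x)) ∧
    (∀ x y, q x y = q y x) ∧
    (∃ c, 0 < c ∧ ∀ x y, c ≤ q x y) ∧
    ∀ θ x, P θ x = metropolisHastings ν q (biased ν A p θ) x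

end Target

end SHUS

end

namespace SHUS

/-! ### Deterministic recursion for the weights along a trajectory. -/

section Pathwise

variable {𝕏 : Type*} {d : ℕ} {A : Fin d → Set 𝕏} {γ : ℝ} {hγ : 0 < γ}

/-! Let `S` be the total weight. A visit to stratum `i` adds `γ w(i) / S`, which is at most `γ`, so
`S` grows at most linearly; it also raises `S ^ 2` by at least `2 γ w(i)` (`le_sq_sum_weight`).
Bounding `w(i)` below by the initial weights gives part (1) on every trajectory.

For part (2) that lower bound must grow. The sum `V` of the inverse weights has negative drift: the
lightest stratum carries at least `V / d`, is hit with probability at least some `c > 0`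
(`exists_le_kernel`), and a hit removes the fraction `γ / (S + γ)` of its inverse weight, which is
at least of order `1 / n`. Hence `V` times a shifted `n ^ (c / d)` is a nonnegative supermartingale,
almost surely bounded. All weights then grow at least like `n ^ (c / d)`, and the same growth
estimate for `S ^ 2` yields the rate with the deterministic `C = c / d`. -/

theorem IsStrata.exists_mem [MeasurableSpace 𝕏] (hA : IsStrata A) (x : 𝕏) : ∃ i, x ∈ A i := by
  have : x ∈ ⋃ i, A i := hA.iUnion_eq ▸ Set.mem_univ x
  simpa using this

theorem IsStrata.indicator_eq [MeasurableSpace 𝕏] (hA : IsStrata A) {x : 𝕏} {i : Fin d}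
    (hx : x ∈ A i) (j : Fin d) :
    (A j).indicator (1 : 𝕏 → ℝ) x = if j = i then 1 else 0 := by
  split_ifs with h
  · subst h; simp [hx]
  · exact Set.indicator_of_notMem (fun hj => (hA.disjoint h).le_bot ⟨hj, hx⟩) _

variable [NeZero d]

theorem update_apply (w : PosWeight d) (x : 𝕏) (i : Fin d) :
    (update A γ hγ w x).1 i =
      w.1 i * (1 + γ / (∑ j, w.1 j) * (A i).indicator 1 x) := by
  simp only [update, normalize]
  ring

theorem sum_update [MeasurableSpace 𝕏] (hA : IsStrata A) (w : PosWeight d) {x : 𝕏} {i : Fin d}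
    (hx : x ∈ A i) :
    ∑ j, (update A γ hγ w x).1 j = ∑ j, w.1 j + γ * (w.1 i / ∑ j, w.1 j) := by
  simp [update, normalize, hA.indicator_eq hx, Finset.sum_add_distrib]

theorem le_update (w : PosWeight d) (x : 𝕏) (i : Fin d) :
    w.1 i ≤ (update A γ hγ w x).1 i := by
  rw [update_apply]
  have h : 0 ≤ γ / (∑ j, w.1 j) * (A i).indicator (1 : 𝕏 → ℝ) x :=
    mul_nonneg (div_pos hγ w.sum_pos).le (Set.indicator_nonneg (fun _ _ => zero_le_one) x)
  exact le_mul_of_one_le_right (w.2 i).le (by linarith)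

/-- The indicator enters linearly, so conditional expectations of inverse weights reduce to visit
probabilities. -/
theorem inv_update (w : PosWeight d) (x : 𝕏) (i : Fin d) :
    ((update A γ hγ w x).1 i)⁻¹ =
      (w.1 i)⁻¹ - (w.1 i)⁻¹ * (γ / (∑ j, w.1 j + γ)) * (A i).indicator 1 x := by
  have hw := w.2 i
  have hS := w.sum_pos
  rw [update_apply]
  by_cases hx : x ∈ A i
  · simp only [hx, Set.indicator_of_mem, Pi.one_apply, mul_one]
    have : ∑ j, w.1 j + γ ≠ 0 := by positivity
    field_simp
    ring
  · simp [hx]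

theorem le_weight (w₀ : PosWeight d) (x : ℕ → 𝕏) (n : ℕ) (i : Fin d) :
    w₀.1 i ≤ (weight A γ hγ w₀ x n).1 i := by
  induction n with
  | zero => exact le_rfl
  | succ n ih => exact ih.trans (le_update _ _ _)

theorem stepsize_succ (w₀ : PosWeight d) (x : ℕ → 𝕏) (n : ℕ) :
    stepsize A γ hγ w₀ x (n + 1) = γ / ∑ j, (weight A γ hγ w₀ x n).1 j := rfl

theorem sum_weight_lt_succ [MeasurableSpace 𝕏] (hA : IsStrata A) (w₀ : PosWeight d)
    (x : ℕ → 𝕏) (n : ℕ) :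
    ∑ j, (weight A γ hγ w₀ x n).1 j < ∑ j, (weight A γ hγ w₀ x (n + 1)).1 j := by
  obtain ⟨i, hi⟩ := hA.exists_mem (x (n + 1))
  rw [weight, sum_update hA _ hi]
  have := div_pos ((weight A γ hγ w₀ x n).2 i) (weight A γ hγ w₀ x n).sum_pos
  nlinarith [mul_pos hγ this]

theorem sum_weight_le [MeasurableSpace 𝕏] (hA : IsStrata A) (w₀ : PosWeight d)
    (x : ℕ → 𝕏) (n : ℕ) :
    ∑ j, (weight A γ hγ w₀ x n).1 j ≤ ∑ j, w₀.1 j + n * γ := by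
  induction n with
  | zero => simp [weight]
  | succ n ih =>
    obtain ⟨i, hi⟩ := hA.exists_mem (x (n + 1))
    rw [weight, sum_update hA _ hi]
    have h : (weight A γ hγ w₀ x n).1 i / ∑ j, (weight A γ hγ w₀ x n).1 j ≤ 1 :=
      div_le_one_of_le₀ (Finset.single_le_sum (fun j _ => ((weight A γ hγ w₀ x n).2 j).le)
        (Finset.mem_univ i)) (weight A γ hγ w₀ x n).sum_pos.le
    push_cast
    nlinarith [mul_le_mul_of_nonneg_left h hγ.le]

/-- A lower bound on all the weights makes the squared total weight grow accordingly. -/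
theorem le_sq_sum_weight [MeasurableSpace 𝕏] (hA : IsStrata A) (w₀ : PosWeight d)
    (x : ℕ → 𝕏) (b : ℕ → ℝ) (hb : ∀ n i, b n ≤ (weight A γ hγ w₀ x n).1 i) (n : ℕ) :
    (∑ j, w₀.1 j) ^ 2 + 2 * γ * ∑ k ∈ Finset.range n, b k ≤
      (∑ j, (weight A γ hγ w₀ x n).1 j) ^ 2 := by
  induction n with
  | zero => simp [weight]
  | succ n ih =>
    obtain ⟨i, hi⟩ := hA.exists_mem (x (n + 1))
    rw [weight, sum_update hA _ hi, Finset.sum_range_succ]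
    have hS := (weight A γ hγ w₀ x n).sum_pos
    have h := mul_le_mul_of_nonneg_left (hb n i) hγ.le
    set S := ∑ j, (weight A γ hγ w₀ x n).1 j
    set v := (weight A γ hγ w₀ x n).1 i
    -- `S` cancels in the cross term, which is why the square is the right quantity to follow.
    have : (S + γ * (v / S)) ^ 2 = S ^ 2 + 2 * (γ * v) + (γ * (v / S)) ^ 2 := by
      field_simp; ring
    nlinarith [sq_nonneg (γ * (v / S))]

theorem strictAntiOn_stepsize [MeasurableSpace 𝕏] (hA : IsStrata A) (w₀ : PosWeight d)
    (x : ℕ → 𝕏) : StrictAntiOn (stepsize A γ hγ w₀ x) (Set.Ici 1) := by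
  have hS : StrictMono fun n => ∑ j, (weight A γ hγ w₀ x n).1 j :=
    strictMono_nat_of_lt_succ (sum_weight_lt_succ hA w₀ x)
  intro m hm n _ hmn
  -- Needed because of truncated subtraction: indices `0` and `1` give the same stepsize.
  have hm' : 1 ≤ m := hm
  exact div_lt_div_of_pos_left hγ (weight A γ hγ w₀ x (m - 1)).sum_pos
    (hS (show m - 1 < n - 1 by omega))

theorem le_stepsize [MeasurableSpace 𝕏] (hA : IsStrata A) (w₀ : PosWeight d)
    (x : ℕ → 𝕏) (n : ℕ) :
    stepsize A γ hγ w₀ x 1 / (1 + n * stepsize A γ hγ w₀ x 1) ≤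
      stepsize A γ hγ w₀ x (n + 1) := by
  have hS₀ := w₀.sum_pos
  rw [show stepsize A γ hγ w₀ x 1 = γ / ∑ j, w₀.1 j from rfl, stepsize_succ]
  have h : γ / (∑ j, w₀.1 j) / (1 + n * (γ / ∑ j, w₀.1 j)) = γ / (∑ j, w₀.1 j + n * γ) := by
    field_simp
  rw [h]
  exact div_le_div_of_nonneg_left hγ.le (weight A γ hγ w₀ x n).sum_pos
    (sum_weight_le hA w₀ x n)

theorem stepsize_le [MeasurableSpace 𝕏] (hA : IsStrata A) (w₀ : PosWeight d)
    (x : ℕ → 𝕏) (n : ℕ) :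
    stepsize A γ hγ w₀ x (n + 1) ≤
      stepsize A γ hγ w₀ x 1 / Real.sqrt (1 + 2 * n * stepsize A γ hγ w₀ x 1 *
        Finset.univ.inf' Finset.univ_nonempty (theta A γ hγ w₀ x 0).1) := by
  have hS₀ := w₀.sum_pos
  rw [show stepsize A γ hγ w₀ x 1 = γ / ∑ j, w₀.1 j from rfl, stepsize_succ]
  set t := Finset.univ.inf' Finset.univ_nonempty (theta A γ hγ w₀ x 0).1
  have ht : 0 < t := (Finset.lt_inf'_iff _).2 fun i _ => (theta A γ hγ w₀ x 0).2.1 i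
  have hb : ∀ n i, t * ∑ j, w₀.1 j ≤ (weight A γ hγ w₀ x n).1 i := fun n i => by
    refine le_trans ?_ (le_weight w₀ x n i)
    have : t ≤ w₀.1 i / ∑ j, w₀.1 j :=
      Finset.inf'_le (theta A γ hγ w₀ x 0).1 (Finset.mem_univ i)
    rwa [le_div_iff₀ hS₀] at this
  have h := le_sq_sum_weight hA w₀ x _ hb n
  rw [Finset.sum_const, Finset.card_range, nsmul_eq_mul] at h
  rw [div_div]
  refine div_le_div_of_nonneg_left hγ.le (by positivity) ?_
  refine (pow_le_pow_iff_left₀ (by positivity) (weight A γ hγ w₀ x n).sum_pos.le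
    two_ne_zero).1 ?_
  rw [mul_pow, Real.sq_sqrt (by positivity)]
  refine le_trans (le_of_eq ?_) h
  field_simp

end Pathwise

/-! ### Probability of visiting the lightest stratum. -/

section Drift

variable {𝕏 : Type*} [MeasurableSpace 𝕏] {d : ℕ}

theorem biased_apply [NeZero d] {ν : Measure 𝕏} {A : Fin d → Set 𝕏} (hA : IsStrata A)
    (p : 𝕏 → ℝ) (θ : Theta d) {x : 𝕏} {i : Fin d} (hx : x ∈ A i) :
    biased ν A p θ x = (∑ j, thetaStar ν A p j / θ.1 j)⁻¹ * (p x / θ.1 i) := by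
  simp [biased, hA.indicator_eq hx]

/-- Moves into a stratum of minimal weight are accepted with probability bounded below. -/
theorem div_le_acceptance_biased [NeZero d] {ν : Measure 𝕏} {A : Fin d → Set 𝕏}
    (hA : IsStrata A) {p : 𝕏 → ℝ} {m M : ℝ} (hm : 0 < m) (hmp : ∀ x, m ≤ p x)
    (hpM : ∀ x, p x ≤ M) {q : 𝕏 → 𝕏 → ℝ} (hq : ∀ x y, q x y = q y x) (hq0 : ∀ x y, 0 < q x y)
    (θ : Theta d) {i : Fin d} (hi : ∀ j, θ.1 i ≤ θ.1 j) (x : 𝕏) {y : 𝕏} (hy : y ∈ A i) :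
    m / M ≤ acceptance q (biased ν A p θ) x y := by
  have hmM : m ≤ M := (hmp x).trans (hpM x)
  have hM : 0 < M := hm.trans_le hmM
  have h1 : m / M ≤ 1 := div_le_one_of_le₀ hmM hM.le
  obtain ⟨k, hk⟩ := hA.exists_mem x
  unfold acceptance
  split_ifs with h
  · exact h1
  refine le_min h1 ?_
  -- By symmetry the proposal density cancels, leaving the ratio of biased densities.
  rw [hq y x, mul_div_mul_right _ _ (hq0 x y).ne']
  rw [biased_apply hA p θ hk] at h ⊢
  -- The normalizing constant cancels too; it is nonzero because this branch excludes a zero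
  -- denominator.
  rw [biased_apply hA p θ hy, mul_div_mul_left _ _ (left_ne_zero_of_mul (left_ne_zero_of_mul h))]
  have hθi := θ.2.1 i
  have hθk := θ.2.1 k
  have hpx : 0 < p x := hm.trans_le (hmp x)
  have hpy : 0 < p y := hm.trans_le (hmp y)
  rw [div_le_div_iff₀ hM (by positivity), mul_div_assoc', div_le_iff₀ hθk]
  calc m * p x ≤ p y * M := mul_le_mul (hmp y) (hpM x) hpx.le hpy.le
    _ = p y / θ.1 i * M * θ.1 i := by field_simp
    _ ≤ p y / θ.1 i * M * θ.1 k := mul_le_mul_of_nonneg_left (hi k) (by positivity)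

/-- A stratum of minimal weight is visited with probability bounded below. -/
theorem exists_le_kernel [NeZero d] {ν : Measure 𝕏} {A : Fin d → Set 𝕏}
    (hA : IsStrata A) {p : 𝕏 → ℝ} {P : Theta d → Kernel 𝕏 𝕏} [∀ θ, IsMarkovKernel (P θ)]
    (hT : TargetAssumption ν A p) (hK : KernelAssumption ν A p P) [Nonempty 𝕏] :
    ∃ c : ℝ, 0 < c ∧ ∀ (θ : Theta d) (x : 𝕏) (i : Fin d), (∀ j, θ.1 i ≤ θ.1 j) →
      c ≤ (P θ x).real (A i) := by
  obtain ⟨⟨m, hm, hmp⟩, ⟨M, hpM⟩, hpos⟩ := hT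
  obtain ⟨q, -, -, hq, ⟨c, hc, hcq⟩, hP⟩ := hK
  obtain ⟨x₁⟩ := ‹Nonempty 𝕏›
  have hM : 0 < M := hm.trans_le ((hmp x₁).trans (hpM x₁))
  -- A real `δ` is interpolated since strata may have infinite measure.
  obtain ⟨δ, hδ, hδν⟩ : ∃ δ : ℝ, 0 < δ ∧ ∀ i, ENNReal.ofReal δ ≤ ν (A i) := by
    have h0 : 0 < Finset.univ.inf' Finset.univ_nonempty (fun i => ν (A i)) :=
      (Finset.lt_inf'_iff _).2 fun i _ => hpos i
    obtain ⟨r, hr0, hr⟩ := ENNReal.lt_iff_exists_nnreal_btwn.1 h0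
    refine ⟨r, by exact_mod_cast hr0, fun i => ?_⟩
    rw [ENNReal.ofReal_coe_nnreal]
    exact hr.le.trans (Finset.inf'_le _ (Finset.mem_univ i))
  refine ⟨c * (m / M) * δ, by positivity, fun θ x i hi => ?_⟩
  have hle : ENNReal.ofReal (c * (m / M) * δ) ≤ P θ x (A i) := by
    rw [hP, metropolisHastings, Measure.add_apply,
      withDensity_apply _ (hA.measurableSet i), ENNReal.ofReal_mul (by positivity)]
    -- The rejection mass at `x` is discarded.
    refine le_trans ?_ le_self_add
    calc ENNReal.ofReal (c * (m / M)) * ENNReal.ofReal δ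
        ≤ ENNReal.ofReal (c * (m / M)) * ν (A i) := by gcongr; exact hδν i
      _ = ∫⁻ _ in A i, ENNReal.ofReal (c * (m / M)) ∂ν := by simp
      _ ≤ _ := by
        refine setLIntegral_mono' (hA.measurableSet i) fun y hy => ?_
        refine ENNReal.ofReal_le_ofReal (mul_le_mul (hcq x y) ?_ (by positivity)
          (hc.le.trans (hcq x y)))
        exact div_le_acceptance_biased hA hm hmp hpM hq
          (fun x y => hc.trans_le (hcq x y)) θ hi x hy
  exact (ENNReal.ofReal_le_iff_le_toReal (measure_ne_top _ _)).1 hle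

end Drift

/-! ### Two estimates on real powers. -/

section Rpow

/-- Two uses of `1 + u ≤ exp u`. This makes the factor `t ^ ε` absorb a drift `1 - ε / t`. -/
theorem rpow_add_one_mul_le {t ε : ℝ} (ht : 0 < t) (hε : 0 ≤ ε) :
    (t + 1) ^ ε * (1 - ε / t) ≤ t ^ ε := by
  have h1 : (t + 1) ^ ε ≤ t ^ ε * Real.exp (ε / t) := by
    have : t + 1 ≤ t * Real.exp (1 / t) := by
      have := mul_le_mul_of_nonneg_left (Real.add_one_le_exp (1 / t)) ht.le
      rwa [mul_add, mul_one, mul_one_div_cancel ht.ne', add_comm] at this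
    calc (t + 1) ^ ε ≤ (t * Real.exp (1 / t)) ^ ε :=
          Real.rpow_le_rpow (by positivity) this hε
      _ = _ := by
          rw [Real.mul_rpow ht.le (Real.exp_pos _).le, ← Real.exp_mul]
          ring_nf
  have h2 : 1 - ε / t ≤ Real.exp (-(ε / t)) := by
    linarith [Real.add_one_le_exp (-(ε / t))]
  calc (t + 1) ^ ε * (1 - ε / t) ≤ (t + 1) ^ ε * Real.exp (-(ε / t)) := by gcongr
    _ ≤ t ^ ε * Real.exp (ε / t) * Real.exp (-(ε / t)) := by gcongr
    _ = t ^ ε := by rw [mul_assoc, ← Real.exp_add]; simp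

/-- A discrete form of integrating `t ^ ε`; each increment is controlled by Bernoulli's inequality.
-/
theorem rpow_le_mul_sum_rpow {ε : ℝ} (hε : 0 ≤ ε) (n : ℕ) :
    (n : ℝ) ^ (1 + ε) ≤ (1 + ε) * ∑ k ∈ Finset.range n, ((k : ℝ) + 1) ^ ε := by
  induction n with
  | zero => simp [Real.zero_rpow (show (1 + ε) ≠ 0 by linarith)]
  | succ n ih =>
    rw [Finset.sum_range_succ, mul_add]
    push_cast
    set s : ℝ := (n : ℝ) + 1 with hs
    have hs1 : 1 ≤ s := by simp [hs]
    have hs0 : 0 < s := by linarith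
    have hb := one_add_mul_self_le_rpow_one_add (s := -1 / s) (p := 1 + ε)
      (by rw [le_div_iff₀ hs0]; linarith) (by linarith)
    have hn : (n : ℝ) ^ (1 + ε) = s ^ (1 + ε) * (1 + -1 / s) ^ (1 + ε) := by
      rw [← Real.mul_rpow hs0.le]
      · congr 1; field_simp; simp [hs]
      · have : 1 / s ≤ 1 := div_le_one_of_le₀ hs1 hs0.le
        rw [neg_div]; linarith
    have hss : s ^ (1 + ε) = s * s ^ ε := by rw [Real.rpow_add hs0, Real.rpow_one]
    have h3 : s ^ (1 + ε) * (1 + (1 + ε) * (-1 / s)) = s ^ (1 + ε) - (1 + ε) * s ^ ε := by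
      rw [hss]; field_simp; ring
    have h4 := mul_le_mul_of_nonneg_left hb (show 0 ≤ s ^ (1 + ε) by positivity)
    rw [h3, ← hn] at h4
    linarith

end Rpow

/-! ### Almost sure boundedness of nonnegative supermartingales. -/

section Martingale

variable {Ω : Type*} {mΩ : MeasurableSpace Ω} {μ : Measure Ω} [IsFiniteMeasure μ]
  {ℱ : Filtration ℕ mΩ} {f : ℕ → Ω → ℝ}

/-- The negative is a submartingale bounded in L¹ by the initial mean, so it converges almost
surely. -/
theorem ae_bddAbove_of_supermartingale (hf : Supermartingale f ℱ μ) (h0 : ∀ n ω, 0 ≤ f n ω) :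
    ∀ᵐ ω ∂μ, BddAbove (Set.range fun n => f n ω) := by
  have hb : ∀ n, eLpNorm ((-f) n) 1 μ ≤ ((∫ ω, f 0 ω ∂μ).toNNReal : ℝ≥0∞) := fun n => by
    have hle : ∫ ω, f n ω ∂μ ≤ ∫ ω, f 0 ω ∂μ := by
      simpa using hf.setIntegral_le (Nat.zero_le n) MeasurableSet.univ
    rw [Pi.neg_apply, eLpNorm_neg, eLpNorm_one_eq_lintegral_enorm,
      ← ofReal_integral_norm_eq_lintegral_enorm (hf.integrable n)]
    refine ENNReal.ofReal_le_ofReal (le_trans (le_of_eq ?_) hle)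
    exact integral_congr_ae (ae_of_all _ fun ω => Real.norm_of_nonneg (h0 n ω))
  filter_upwards [hf.neg.exists_ae_tendsto_of_bdd hb] with ω ⟨c, hc⟩
  have := hc.neg.bddAbove_range
  simpa using this

end Martingale

/-! ### Drift of the inverse weights and the resulting stepsize rate. -/

section Supermartingale

variable {d : ℕ}

/-- The sum of the inverse weights. -/
noncomputable def sumInv (w : PosWeight d) : ℝ := ∑ i, (w.1 i)⁻¹

theorem sumInv_nonneg (w : PosWeight d) : 0 ≤ sumInv w :=
  Finset.sum_nonneg fun i _ => (inv_pos.2 (w.2 i)).le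

variable [NeZero d] {𝕏 : Type*} [MeasurableSpace 𝕏] {A : Fin d → Set 𝕏} {γ : ℝ} {hγ : 0 < γ}
  {Ω : Type*} {X : ℕ → Ω → 𝕏}

theorem measurable_weight (hA : IsStrata A) (w₀ : PosWeight d) (n : ℕ) (i : Fin d) :
    Measurable[past X n] fun ω => (weight A γ hγ w₀ (fun k => X k ω) n).1 i := by
  induction n generalizing i with
  | zero => exact measurable_const (a := w₀.1 i)
  | succ n ih =>
    have hm : past X n ≤ past X (n + 1) :=
      iSup₂_mono' fun k hk => ⟨k, hk.trans n.le_succ, le_rfl⟩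
    have ih' : ∀ i, Measurable[past X (n + 1)]
        fun ω => (weight A γ hγ w₀ (fun k => X k ω) n).1 i := fun i => (ih i).mono hm le_rfl
    have hXm : Measurable[past X (n + 1)] (X (n + 1)) :=
      (comap_measurable (X (n + 1))).mono
        (le_iSup₂ (f := fun k (_ : k ≤ n + 1) => MeasurableSpace.comap (X k) inferInstance)
          (n + 1) le_rfl) le_rfl
    have hind : Measurable[past X (n + 1)]
        fun ω => (A i).indicator (1 : 𝕏 → ℝ) (X (n + 1) ω) :=
      (measurable_one.indicator (hA.measurableSet i)).comp hXm
    simp only [weight, update_apply]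
    exact (ih' i).mul (((Finset.measurable_fun_sum _ fun j _ => ih' j).const_div γ).mul hind
      |>.const_add 1)

variable [MeasurableSpace Ω]

/-- The filtration generated by the samples. -/
def pastFiltration (hX : ∀ n, Measurable (X n)) : Filtration ℕ ‹MeasurableSpace Ω› where
  seq := past X
  mono' _ _ h := iSup₂_mono' fun k hk => ⟨k, hk.trans h, le_rfl⟩
  le' _ := iSup₂_le fun k _ => (hX k).comap_le

/-- The drift of the sum of the inverse weights: a stratum of minimal weight contributes at least
the fraction `1 / d` of the sum, and it is visited with probability at least `c`. -/
theorem condExp_sumInv_le {P : Theta d → Kernel 𝕏 𝕏} {μ : Measure Ω} [IsProbabilityMeasure μ]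
    {x₀ : 𝕏} {w₀ : PosWeight d} (hA : IsStrata A) (hX : IsSHUS A P γ hγ x₀ w₀ μ X)
    {c : ℝ} (hc : 0 < c)
    (hPc : ∀ (θ : Theta d) (x : 𝕏) (i : Fin d), (∀ j, θ.1 i ≤ θ.1 j) → c ≤ (P θ x).real (A i))
    (n : ℕ) :
    μ[fun ω => sumInv (weight A γ hγ w₀ (fun k => X k ω) (n + 1)) | past X n] ≤ᵐ[μ]
      fun ω => sumInv (weight A γ hγ w₀ (fun k => X k ω) n) *
        (1 - c / d / ((∑ j, w₀.1 j) / γ + n + 1)) := by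
  have hle : past X n ≤ ‹MeasurableSpace Ω› := (pastFiltration hX.measurable).le n
  let w : Ω → PosWeight d := fun ω => weight A γ hγ w₀ (fun k => X k ω) n
  let V : Ω → ℝ := fun ω => sumInv (w ω)
  let a : Fin d → Ω → ℝ := fun i ω => ((w ω).1 i)⁻¹ * (γ / (∑ j, (w ω).1 j + γ))
  let φ : Fin d → Ω → ℝ := fun i => (X (n + 1) ⁻¹' A i).indicator fun _ => (1 : ℝ)
  have hw : ∀ i, Measurable[past X n] fun ω => (w ω).1 i := measurable_weight hA w₀ n
  have hVm : Measurable[past X n] V := Finset.measurable_fun_sum _ fun i _ => (hw i).inv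
  have ham : ∀ i, Measurable[past X n] (a i) := fun i =>
    (hw i).inv.mul (((Finset.measurable_fun_sum _ fun j _ => hw j).add_const γ).const_div γ)
  have hinv : ∀ i ω, ((w ω).1 i)⁻¹ ≤ (w₀.1 i)⁻¹ := fun i ω =>
    inv_anti₀ (w₀.2 i) (le_weight w₀ _ n i)
  have hVint : Integrable V μ := by
    refine Integrable.of_bound (hVm.mono hle le_rfl).aestronglyMeasurable (sumInv w₀)
      (ae_of_all _ fun ω => ?_)
    rw [Real.norm_of_nonneg (sumInv_nonneg _)]
    exact Finset.sum_le_sum fun i _ => hinv i ω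
  have ha0 : ∀ i ω, 0 ≤ a i ω := fun i ω =>
    mul_nonneg (inv_pos.2 ((w ω).2 i)).le (div_pos hγ (add_pos (w ω).sum_pos hγ)).le
  have hab : ∀ i, ∀ᵐ ω ∂μ, ‖a i ω‖ ≤ (w₀.1 i)⁻¹ := fun i => ae_of_all _ fun ω => by
    rw [Real.norm_of_nonneg (ha0 i ω)]
    refine le_trans (mul_le_of_le_one_right (inv_pos.2 ((w ω).2 i)).le ?_) (hinv i ω)
    have := (w ω).sum_pos
    exact div_le_one_of_le₀ (by linarith) (by linarith)
  have hφint : ∀ i, Integrable (φ i) μ := fun i =>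
    (integrable_const (1 : ℝ)).indicator (hX.measurable _ (hA.measurableSet i))
  have haφ : ∀ i, Integrable (a i * φ i) μ := fun i =>
    (hφint i).bdd_mul ((ham i).mono hle le_rfl).aestronglyMeasurable (hab i)
  have hsucc : (fun ω => sumInv (weight A γ hγ w₀ (fun k => X k ω) (n + 1))) =
      V - ∑ i, a i * φ i := by
    funext ω
    simp only [sumInv, weight, inv_update, Finset.sum_sub_distrib, Pi.sub_apply,
      Finset.sum_apply, Pi.mul_apply]
    rfl
  have h1 : μ[V - ∑ i, a i * φ i | past X n] =ᵐ[μ] μ[V | past X n] - μ[∑ i, a i * φ i | past X n] :=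
    condExp_sub hVint (integrable_finsetSum' _ fun i _ => haφ i) _
  have h2 : μ[V | past X n] = V :=
    condExp_of_stronglyMeasurable hle hVm.stronglyMeasurable hVint
  have h3 := condExp_finsetSum (μ := μ) (s := Finset.univ) (f := fun i => a i * φ i)
    (fun i _ => haφ i) (past X n)
  have h4 : ∀ᵐ ω ∂μ, ∀ i, (μ[a i * φ i | past X n]) ω =
      a i ω * (P (theta A γ hγ w₀ (fun k => X k ω) n) (X n ω)).real (A i) := by
    refine ae_all_iff.2 fun i => ?_
    filter_upwards [condExp_stronglyMeasurable_mul_of_bound hle (ham i).stronglyMeasurable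
      (hφint i) _ (hab i), hX.transition n (A i) (hA.measurableSet i)] with ω h5 h6
    rw [h5, Pi.mul_apply, h6]
  rw [hsucc]
  filter_upwards [h1, h3, h4] with ω h1 h3 h4
  rw [h1, Pi.sub_apply, h2, h3, Finset.sum_apply]
  simp only [h4]
  obtain ⟨i, -, hi⟩ := Finset.exists_min_image Finset.univ (w ω).1 Finset.univ_nonempty
  have hS := (w ω).sum_pos
  have hS₀ := w₀.sum_pos
  have hd : (0 : ℝ) < d := Nat.cast_pos.2 (NeZero.pos d)
  have hp : c ≤ (P (theta A γ hγ w₀ (fun k => X k ω) n) (X n ω)).real (A i) :=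
    hPc _ _ i fun j => div_le_div_of_nonneg_right (hi j (Finset.mem_univ j)) hS.le
  have hV : V ω / d ≤ ((w ω).1 i)⁻¹ := by
    rw [div_le_iff₀ hd]
    calc V ω ≤ ∑ _j : Fin d, ((w ω).1 i)⁻¹ :=
          Finset.sum_le_sum fun j _ => inv_anti₀ ((w ω).2 i) (hi j (Finset.mem_univ j))
      _ = ((w ω).1 i)⁻¹ * d := by simp [mul_comm]
  -- This is the linear growth bound on the total weight, divided by `γ`; the `+ 1` is the extra
  -- `γ`.
  have hg : 1 / ((∑ j, w₀.1 j) / γ + n + 1) ≤ γ / (∑ j, (w ω).1 j + γ) := by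
    have : 1 / ((∑ j, w₀.1 j) / γ + n + 1) = γ / (∑ j, w₀.1 j + n * γ + γ) := by
      field_simp
    rw [this]
    refine div_le_div_of_nonneg_left hγ.le (by positivity) ?_
    have := sum_weight_le (hγ := hγ) hA w₀ (fun k => X k ω) n
    exact add_le_add_left this γ
  have hV0 : 0 ≤ V ω := sumInv_nonneg _
  have hkey : V ω * (c / d / ((∑ j, w₀.1 j) / γ + n + 1)) ≤
      ∑ i, a i ω * (P (theta A γ hγ w₀ (fun k => X k ω) n) (X n ω)).real (A i) := by
    calc V ω * (c / d / ((∑ j, w₀.1 j) / γ + n + 1))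
        = V ω / d * (1 / ((∑ j, w₀.1 j) / γ + n + 1)) * c := by ring
      _ ≤ a i ω * (P (theta A γ hγ w₀ (fun k => X k ω) n) (X n ω)).real (A i) := by
          refine mul_le_mul (mul_le_mul hV hg (by positivity) (inv_pos.2 ((w ω).2 i)).le)
            hp hc.le (ha0 i ω)
      _ ≤ _ := Finset.single_le_sum (f := fun i => a i ω *
          (P (theta A γ hγ w₀ (fun k => X k ω) n) (X n ω)).real (A i))
          (fun j _ => mul_nonneg (ha0 j ω) measureReal_nonneg) (Finset.mem_univ i)
  change V ω - _ ≤ V ω * _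
  linarith

/-- The power compensates the drift of `condExp_sumInv_le`, with `t = (∑ j, w₀.1 j) / γ + n + 1` and
`ε = c / d`. -/
theorem ae_bddAbove_rpow_mul_sumInv {P : Theta d → Kernel 𝕏 𝕏} {μ : Measure Ω}
    [IsProbabilityMeasure μ] {x₀ : 𝕏} {w₀ : PosWeight d} (hA : IsStrata A)
    (hX : IsSHUS A P γ hγ x₀ w₀ μ X) {c : ℝ} (hc : 0 < c)
    (hPc : ∀ (θ : Theta d) (x : 𝕏) (i : Fin d), (∀ j, θ.1 i ≤ θ.1 j) → c ≤ (P θ x).real (A i)) :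
    ∀ᵐ ω ∂μ, BddAbove (Set.range fun n : ℕ => ((∑ j, w₀.1 j) / γ + n + 1) ^ (c / d) *
      sumInv (weight A γ hγ w₀ (fun k => X k ω) n)) := by
  have hS₀ := w₀.sum_pos
  have hm : ∀ n, Measurable[past X n] fun ω => sumInv (weight A γ hγ w₀ (fun k => X k ω) n) :=
    fun n => Finset.measurable_fun_sum _ fun i _ => (measurable_weight hA w₀ n i).inv
  have hle : ∀ n, past X n ≤ ‹MeasurableSpace Ω› := (pastFiltration hX.measurable).le
  have hint : ∀ n, Integrable (fun ω => sumInv (weight A γ hγ w₀ (fun k => X k ω) n)) μ := by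
    intro n
    refine Integrable.of_bound ((hm n).mono (hle n) le_rfl).aestronglyMeasurable (sumInv w₀)
      (ae_of_all _ fun ω => ?_)
    rw [Real.norm_of_nonneg (sumInv_nonneg _)]
    exact Finset.sum_le_sum fun i _ => inv_anti₀ (w₀.2 i) (le_weight w₀ _ n i)
  refine ae_bddAbove_of_supermartingale (ℱ := pastFiltration hX.measurable)
    (f := fun n ω => ((∑ j, w₀.1 j) / γ + n + 1) ^ (c / d) *
      sumInv (weight A γ hγ w₀ (fun k => X k ω) n))
    (supermartingale_nat (fun n => ((hm n).const_mul _).stronglyMeasurable)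
      (fun n => (hint n).const_mul _) fun n => ?_)
    (fun n ω => mul_nonneg (by positivity) (sumInv_nonneg _))
  have h1 := condExp_smul (μ := μ) (((∑ j, w₀.1 j) / γ + (n + 1 : ℕ) + 1) ^ (c / d))
    (fun ω => sumInv (weight A γ hγ w₀ (fun k => X k ω) (n + 1))) (past X n)
  filter_upwards [h1, condExp_sumInv_le hA hX hc hPc n] with ω h1 h2
  refine (le_of_eq h1).trans ?_
  rw [Pi.smul_apply, smul_eq_mul]
  refine (mul_le_mul_of_nonneg_left h2 (by positivity)).trans ?_
  have h3 := mul_le_mul_of_nonneg_right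
    (rpow_add_one_mul_le (t := (∑ j, w₀.1 j) / γ + n + 1) (ε := c / d)
      (by positivity) (by positivity))
    (sumInv_nonneg (weight A γ hγ w₀ (fun k => X k ω) n))
  refine le_trans (le_of_eq ?_) h3
  push_cast
  ring_nf

/-- Each inverse weight is at most the sum, so every weight is at least `(n + 1) ^ ε / K`; summing
this in `le_sq_sum_weight` makes the squared total at least of order `n ^ (1 + ε)`. -/
theorem bddAbove_rpow_mul_stepsize (hA : IsStrata A) {w₀ : PosWeight d} {x : ℕ → 𝕏} {ε : ℝ}
    (hε : 0 < ε)
    (hb : BddAbove (Set.range fun n : ℕ => ((∑ j, w₀.1 j) / γ + n + 1) ^ ε *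
      sumInv (weight A γ hγ w₀ x n))) :
    BddAbove (Set.range fun n : ℕ => (n : ℝ) ^ ((1 + ε) / 2) * stepsize A γ hγ w₀ x (n + 1)) := by
  obtain ⟨K, hK⟩ := hb
  replace hK : ∀ n : ℕ, ((∑ j, w₀.1 j) / γ + n + 1) ^ ε * sumInv (weight A γ hγ w₀ x n) ≤ K :=
    fun n => hK ⟨n, rfl⟩
  have hS₀ := w₀.sum_pos
  have hVpos : ∀ w : PosWeight d, 0 < sumInv w := fun w =>
    Finset.sum_pos (fun i _ => inv_pos.2 (w.2 i)) Finset.univ_nonempty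
  have hK0 : 0 < K := lt_of_lt_of_le
    (mul_pos (Real.rpow_pos_of_pos (by positivity) _) (hVpos _)) (hK 0)
  have hw : ∀ (n : ℕ) i, ((n : ℝ) + 1) ^ ε / K ≤ (weight A γ hγ w₀ x n).1 i := fun n i => by
    have hwi := (weight A γ hγ w₀ x n).2 i
    have h1 : ((weight A γ hγ w₀ x n).1 i)⁻¹ ≤ sumInv (weight A γ hγ w₀ x n) :=
      Finset.single_le_sum (f := fun i => ((weight A γ hγ w₀ x n).1 i)⁻¹)
        (fun j _ => (inv_pos.2 ((weight A γ hγ w₀ x n).2 j)).le) (Finset.mem_univ i)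
    have h2 : ((n : ℝ) + 1) ^ ε ≤ ((∑ j, w₀.1 j) / γ + n + 1) ^ ε :=
      Real.rpow_le_rpow (by positivity)
        (by have : 0 < (∑ j, w₀.1 j) / γ := by positivity
            linarith) hε.le
    have h3 := (mul_le_mul h2 h1 (inv_pos.2 hwi).le (by positivity)).trans (hK n)
    rw [← div_eq_mul_inv, div_le_iff₀ hwi] at h3
    rwa [div_le_iff₀ hK0, mul_comm]
  refine ⟨γ * Real.sqrt (K * (1 + ε) / (2 * γ)), ?_⟩
  rintro _ ⟨n, rfl⟩
  have hS := (weight A γ hγ w₀ x n).sum_pos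
  have h1 := le_sq_sum_weight hA w₀ x _ hw n
  have h2 := rpow_le_mul_sum_rpow hε.le n
  rw [← Finset.sum_div] at h1
  simp only [stepsize_succ]
  set S := ∑ j, (weight A γ hγ w₀ x n).1 j
  set T := ∑ k ∈ Finset.range n, ((k : ℝ) + 1) ^ ε
  have h3 : (n : ℝ) ^ (1 + ε) ≤ K * (1 + ε) / (2 * γ) * S ^ 2 :=
    calc (n : ℝ) ^ (1 + ε) ≤ (1 + ε) * T := h2
      _ = K * (1 + ε) / (2 * γ) * (2 * γ * (T / K)) := by field_simp
      _ ≤ _ := by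
        refine mul_le_mul_of_nonneg_left ?_ (by positivity)
        linarith [sq_nonneg (∑ j, w₀.1 j)]
  have h4 : (n : ℝ) ^ ((1 + ε) / 2) ≤ Real.sqrt (K * (1 + ε) / (2 * γ)) * S := by
    have h5 : (n : ℝ) ^ ((1 + ε) / 2) = Real.sqrt ((n : ℝ) ^ (1 + ε)) := by
      rw [Real.sqrt_eq_rpow, ← Real.rpow_mul (Nat.cast_nonneg n)]
      ring_nf
    rw [h5, ← Real.sqrt_sq hS.le, ← Real.sqrt_mul (by positivity)]
    exact Real.sqrt_le_sqrt h3
  calc (n : ℝ) ^ ((1 + ε) / 2) * (γ / S)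
      ≤ Real.sqrt (K * (1 + ε) / (2 * γ)) * S * (γ / S) :=
        mul_le_mul_of_nonneg_right h4 (by positivity)
    _ = γ * Real.sqrt (K * (1 + ε) / (2 * γ)) := by field_simp

end Supermartingale

end SHUS

theorem proposition1 {D d : ℕ} [NeZero d]
    (𝕏 : Set (EuclideanSpace ℝ (Fin D))) (h𝕏 : MeasurableSet 𝕏)
    (A : Fin d → Set 𝕏) (hA : SHUS.IsStrata A)
    (p : 𝕏 → ℝ) (hp : SHUS.IsProbDensity (Measure.comap Subtype.val volume) p)
    (P : SHUS.Theta d → Kernel 𝕏 𝕏) (hP : ∀ θ, IsMarkovKernel (P θ))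
    (γ : ℝ) (hγ : 0 < γ) (x₀ : 𝕏) (w₀ : SHUS.PosWeight d)
    {Ω : Type*} [MeasurableSpace Ω] (μ : Measure Ω) [IsProbabilityMeasure μ]
    (X : ℕ → Ω → 𝕏) (hX : SHUS.IsSHUS A P γ hγ x₀ w₀ μ X) :
    (∀ᵐ ω ∂μ,
      StrictAntiOn (SHUS.stepsize A γ hγ w₀ (fun k => X k ω)) (Set.Ici 1) ∧
      ∀ n : ℕ,
        SHUS.stepsize A γ hγ w₀ (fun k => X k ω) 1 /
            (1 + n * SHUS.stepsize A γ hγ w₀ (fun k => X k ω) 1) ≤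
          SHUS.stepsize A γ hγ w₀ (fun k => X k ω) (n + 1) ∧
        SHUS.stepsize A γ hγ w₀ (fun k => X k ω) (n + 1) ≤
          SHUS.stepsize A γ hγ w₀ (fun k => X k ω) 1 /
            Real.sqrt (1 + 2 * n * SHUS.stepsize A γ hγ w₀ (fun k => X k ω) 1 *
              Finset.univ.inf' Finset.univ_nonempty
                (SHUS.theta A γ hγ w₀ (fun k => X k ω) 0).1)) ∧
    (SHUS.TargetAssumption (Measure.comap Subtype.val volume) A p →
      SHUS.KernelAssumption (Measure.comap Subtype.val volume) A p P →
      ∃ C : Ω → ℝ, Measurable C ∧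
        ∀ᵐ ω ∂μ, 0 < C ω ∧
          BddAbove (Set.range fun n : ℕ =>
            (n : ℝ) ^ ((1 + C ω) / 2) *
              SHUS.stepsize A γ hγ w₀ (fun k => X k ω) (n + 1))) := by
  refine ⟨ae_of_all _ fun ω => ⟨SHUS.strictAntiOn_stepsize hA w₀ _, fun n =>
    ⟨SHUS.le_stepsize hA w₀ _ n, SHUS.stepsize_le hA w₀ _ n⟩⟩, fun hT hK => ?_⟩
  have : Nonempty 𝕏 := ⟨x₀⟩
  obtain ⟨c, hc, hPc⟩ := SHUS.exists_le_kernel hA hT hK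
  have hd : (0 : ℝ) < d := Nat.cast_pos.2 (NeZero.pos d)
  refine ⟨fun _ => c / d, measurable_const, ?_⟩
  filter_upwards [SHUS.ae_bddAbove_rpow_mul_sumInv hA hX hc hPc] with ω hω
  exact ⟨by positivity, SHUS.bddAbove_rpow_mul_stepsize hA (by positivity) hω⟩
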